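/- Let $\mathfrak g$ be a complex simple Lie algebra with Cartan subalgebra $\mathfrak h$, simple roots $\alpha_1,\dots,\alpha_d$, weight lattice $X$, half-sum of positive roots $\rho$, and Weyl group $W$ generated by the simple reflections $s_1,\dots,s_d$; let $m_{kl}$ be the order of $s_ks_l$. Let $\mathcal A=\mathbb Z[q,q^{-1}]$, and let $\mathcal H$ be the $\mathcal A$-algebra generated by $H_1,\dots,H_d$ with relations $(H_k-q^{-1})(H_k+q)=0$ and $H_kH_lH_k\cdots=H_lH_kH_l\cdots$ ($m_{kl}$ factors on each side) for $k\neq l$. Its bar involution is the ring automorphism with $\overline q=q^{-1}$ and $\overline{H_k}=H_k^{-1}$. Let $X_{\mathtt f}\subset X$ be a finite subset, stable under the dot action $w\cdot\lambda=w(\lambda+\rho)-\rho$ and containing a regular orbit, and put $\bar X_{\mathtt f}=X_{\mathtt f}+\rho$, with the right $W$-action $\mathbf i w=w^{-1}(\mathbf i)$. Call $\mathbf i\in\bar X_{\mathtt f}$ anti-dominant if $\langle\mathbf i,\alpha_k^\vee\rangle\le 0$ for all $k$, and write $\mathbf i\preceq\mathbf j$ if $\mathbf j-\mathbf i\in\sum_k\mathbb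 N\alpha_k$. Let $\mathbb T_{\mathtt f}=\bigoplus_{\mathbf i\in\bar X_{\mathtt f}}\mathcal A v_{\mathbf i}$ be the right $\mathcal H$-module with $$v_{\mathbf i}H_k=\begin{cases}q^{-1}v_{\mathbf i}&\text{if }\mathbf i s_k=\mathbf i,\\ v_{\mathbf i s_k}&\text{if }\mathbf i s_k\succ\mathbf i,\\ v_{\mathbf i s_k}+(q^{-1}-q)v_{\mathbf i}&\text{if }\mathbf i s_k\prec\mathbf i,\end{cases}$$ and let $\mathcal S_q=\mathrm{End}_{\mathcal H}(\mathbb T_{\mathtt f})$ be the $q$-Schur algebra. Then: 1. There is a unique map $v\mapsto\overline v$ on $\mathbb T_{\mathtt f}$ that is additive, satisfies $\overline{av}=\overline a\,\overline v$ for $a\in\mathcal A$, fixes $v_{\mathbf i}$ for every anti-dominant $\mathbf i\in\bar X_{\mathtt f}$, and satisfies $\overline{v_{\mathbf i}h}=\overline{v_{\mathbf i}}\,\overline h$ for all $\mathbf i\in\bar X_{\mathtt f}$, $h\in\mathcal H$. It is an involution. 2. There is a unique map $\eta\mapsto\overline\eta$ on $\mathcal S_q$ with $\overline\eta(v_{\mathbf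 i}h)=\overline{\eta(v_{\mathbf i})}\,h$ for every $\eta\in\mathcal S_q$, every anti-dominant $\mathbf i\in\bar X_{\mathtt f}$ and every $h\in\mathcal H$. It is an involution. 3. The commuting actions of $\mathcal S_q$ and $\mathcal H$ on $\mathbb T_{\mathtt f}$ are compatible with these bar involutions: $$\overline{\eta\cdot v\cdot h}=\overline\eta\cdot\overline v\cdot\overline h\qquad\text{for all }\eta\in\mathcal S_q,\ v\in\mathbb T_{\mathtt f},\ h\in\mathcal H.$$ -/

import Mathlib

set_option linter.unusedSectionVars false

noncomputable section

namespace QSchur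

open LaurentPolynomial

/-- The ground ring `ℤ[q, q⁻¹]`; the indeterminate `q` is `T 1`, and `q⁻¹` is `T (-1)`. -/
abbrev LaurentZ : Type := LaurentPolynomial ℤ

/-- The alternating product `x y x y ⋯` with `n` factors. -/
def braidWord {G : Type*} [Monoid G] (x y : G) : ℕ → G
  | 0 => 1
  | n + 1 => x * braidWord y x n

section Roots

variable {ι R M N : Type*} [Field R] [AddCommGroup M] [Module R M]
  [AddCommGroup N] [Module R N] {P : RootPairing ι R M N}

/-- The integral weights: vectors pairing to integers with every coroot. -/
def weightLattice (P : RootPairing ι R M N) : Set M :=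
  {x | ∀ i, ∃ n : ℤ, P.toLinearMap x (P.coroot i) = n}

/-- The dominance order: `j - i` is a combination of simple roots with coefficients in `ℕ`. -/
def WeightLE (b : P.Base) (i j : M) : Prop :=
  j - i ∈ AddSubmonoid.closure (P.root '' b.support)

/-- The strict dominance order. -/
def WeightLT (b : P.Base) (i j : M) : Prop :=
  WeightLE b i j ∧ i ≠ j

/-- A (`ρ`-shifted) weight is anti-dominant if it pairs to an integer `≤ 0` with every simple
coroot. -/
def IsAntidominant (b : P.Base) (i : M) : Prop :=
  ∀ k ∈ b.support, ∃ n : ℕ, P.toLinearMap i (P.coroot k) = -(n : R)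

/-- The order of `s_k s_l` in the Weyl group. -/
def coxeterOrder (b : P.Base) (k l : b.support) : ℕ :=
  orderOf (RootPairing.weylGroup.ofIdx P k * RootPairing.weylGroup.ofIdx P l)

/-- The defining relations of the Hecke algebra: the quadratic relations and the braid
relations. -/
inductive HeckeRel (b : P.Base) :
    FreeAlgebra LaurentZ b.support → FreeAlgebra LaurentZ b.support → Prop
  | quad (k : b.support) : HeckeRel b
      ((FreeAlgebra.ι LaurentZ k - algebraMap LaurentZ _ (T (-1))) *
        (FreeAlgebra.ι LaurentZ k + algebraMap LaurentZ _ (T 1))) 0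
  | braid (k l : b.support) (hkl : k ≠ l) : HeckeRel b
      (braidWord (FreeAlgebra.ι LaurentZ k) (FreeAlgebra.ι LaurentZ l) (coxeterOrder b k l))
      (braidWord (FreeAlgebra.ι LaurentZ l) (FreeAlgebra.ι LaurentZ k) (coxeterOrder b k l))

/-- The Hecke algebra over `ℤ[q, q⁻¹]`, by generators and relations. -/
def Hecke (b : P.Base) : Type _ := RingQuot (HeckeRel b)

instance (b : P.Base) : Ring (Hecke b) := inferInstanceAs (Ring (RingQuot (HeckeRel b)))

instance (b : P.Base) : Algebra LaurentZ (Hecke b) :=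
  inferInstanceAs (Algebra LaurentZ (RingQuot (HeckeRel b)))

/-- The generator `H_k`. -/
def Hecke.gen (b : P.Base) (k : b.support) : Hecke b :=
  RingQuot.mkAlgHom LaurentZ (HeckeRel b) (FreeAlgebra.ι LaurentZ k)

lemma map_braidWord {G G' F : Type*} [Monoid G] [Monoid G'] [FunLike F G G']
    [MonoidHomClass F G G'] (f : F) (n : ℕ) (x y : G) :
    f (braidWord x y n) = braidWord (f x) (f y) n := by
  induction n generalizing x y with
  | zero => simp [braidWord]
  | succ n ih => simp [braidWord, ih]

/-- Homomorphisms out of the Hecke algebra. -/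
def Hecke.lift (b : P.Base) {B : Type*} [Ring B] [Algebra LaurentZ B] (f : b.support → B)
    (hq : ∀ k, (f k - algebraMap LaurentZ B (T (-1))) * (f k + algebraMap LaurentZ B (T 1)) = 0)
    (hb : ∀ k l, k ≠ l → braidWord (f k) (f l) (coxeterOrder b k l) =
      braidWord (f l) (f k) (coxeterOrder b k l)) : Hecke b →ₐ[LaurentZ] B :=
  RingQuot.liftAlgHom LaurentZ ⟨FreeAlgebra.lift LaurentZ f, by
    rintro x y (k | ⟨k, l, hkl⟩)
    · simpa using hq k
    · simpa [map_braidWord] using hb k l hkl⟩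

lemma Hecke.lift_gen (b : P.Base) {B : Type*} [Ring B] [Algebra LaurentZ B] (f : b.support → B)
    (hq) (hb) (k : b.support) : Hecke.lift b f hq hb (Hecke.gen b k) = f k := by
  refine (RingQuot.liftAlgHom_mkAlgHom_apply LaurentZ (FreeAlgebra.lift LaurentZ f) _ _).trans ?_
  simp

lemma Hecke.quad (b : P.Base) (k : b.support) :
    (Hecke.gen b k - algebraMap LaurentZ _ (T (-1))) *
      (Hecke.gen b k + algebraMap LaurentZ _ (T 1)) = 0 := by
  have := RingQuot.mkAlgHom_rel LaurentZ (HeckeRel.quad (b := b) k)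
  simp only [map_mul, map_sub, map_add, AlgHom.commutes, map_zero] at this
  exact this

lemma Hecke.braid (b : P.Base) (k l : b.support) (hkl : k ≠ l) :
    braidWord (Hecke.gen b k) (Hecke.gen b l) (coxeterOrder b k l) =
      braidWord (Hecke.gen b l) (Hecke.gen b k) (coxeterOrder b k l) := by
  have := RingQuot.mkAlgHom_rel LaurentZ (HeckeRel.braid (b := b) k l hkl)
  rw [map_braidWord, map_braidWord] at this
  exact this

lemma Hecke.hom_ext (b : P.Base) {B : Type*} [Ring B] [Algebra LaurentZ B]
    (f g : Hecke b →ₐ[LaurentZ] B) (h : ∀ k, f (Hecke.gen b k) = g (Hecke.gen b k)) : f = g := by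
  refine RingQuot.ringQuot_ext' LaurentZ f g (FreeAlgebra.hom_ext ?_)
  funext k
  exact h k

/-- The inverse `H_k⁻¹ = H_k + (q - q⁻¹)`. -/
def Hecke.genUnit (b : P.Base) (k : b.support) : (Hecke b)ˣ where
  val := Hecke.gen b k
  inv := Hecke.gen b k + algebraMap LaurentZ _ (T 1 - T (-1))
  val_inv := by
    have h := Hecke.quad b k
    have h1 : algebraMap LaurentZ (Hecke b) (T (-1)) * algebraMap LaurentZ _ (T 1) = 1 := by
      rw [← map_mul, ← T_add]; simp
    have h2 := Algebra.commutes (T (-1) : LaurentZ) (Hecke.gen b k)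
    rw [sub_mul, mul_add, mul_add, h1, h2] at h
    rw [map_sub, mul_add, mul_sub]
    rw [← sub_eq_zero, ← h]; abel
  inv_val := by
    have h := Hecke.quad b k
    have h1 : algebraMap LaurentZ (Hecke b) (T (-1)) * algebraMap LaurentZ _ (T 1) = 1 := by
      rw [← map_mul, ← T_add]; simp
    have h2 := Algebra.commutes (T 1 : LaurentZ) (Hecke.gen b k)
    rw [sub_mul, mul_add, mul_add, h1, ← h2] at h
    rw [map_sub, add_mul, sub_mul]
    rw [← sub_eq_zero, ← h]; abel

lemma braidWord_snoc {G : Type*} [Monoid G] (n : ℕ) (x y : G) :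
    braidWord x y (n + 1) = braidWord x y n * (if Even n then x else y) := by
  induction n generalizing x y with
  | zero => simp [braidWord]
  | succ n ih =>
    rw [braidWord, ih y x]
    by_cases h : Even n <;> simp [braidWord, mul_assoc, h, Nat.even_add_one]

lemma braidWord_inv_mul {G : Type*} [Group G] (n : ℕ) (x y : G) :
    braidWord x⁻¹ y⁻¹ n * (if Even n then braidWord y x n else braidWord x y n) = 1 := by
  induction n with
  | zero => simp [braidWord]
  | succ n ih =>
    rw [braidWord_snoc]
    by_cases h : Even n
    · simp only [h, if_true, Nat.even_add_one, not_true, if_false] at ih ⊢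
      rw [braidWord, mul_assoc, inv_mul_cancel_left, ih]
    · simp only [h, if_false, Nat.even_add_one, not_false_eq_true, if_true] at ih ⊢
      rw [braidWord, mul_assoc, inv_mul_cancel_left, ih]

lemma braidWord_inv_comm {G : Type*} [Group G] (n : ℕ) (x y : G)
    (h : braidWord x y n = braidWord y x n) :
    braidWord x⁻¹ y⁻¹ n = braidWord y⁻¹ x⁻¹ n := by
  have h1 := braidWord_inv_mul n x y
  have h2 := braidWord_inv_mul n y x
  rw [h, ite_self] at h1
  rw [h, ite_self] at h2
  exact mul_right_cancel (h1.trans h2.symm)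

/-- The Hecke algebra with its ℤ[q, q⁻¹]-algebra structure twisted by `q ↦ q⁻¹`. -/
def HeckeTwist (b : P.Base) : Type _ := Hecke b

instance (b : P.Base) : Ring (HeckeTwist b) := inferInstanceAs (Ring (Hecke b))

instance (b : P.Base) : Algebra LaurentZ (HeckeTwist b) :=
  RingHom.toAlgebra' ((algebraMap LaurentZ (Hecke b)).comp
      (invert : LaurentZ ≃ₐ[ℤ] LaurentZ).toRingEquiv.toRingHom)
    fun a x => Algebra.commutes (R := LaurentZ) (A := Hecke b) (invert a) x

lemma HeckeTwist.algebraMap_eq (b : P.Base) (a : LaurentZ) :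
    (algebraMap LaurentZ (HeckeTwist b) a : Hecke b) =
      algebraMap LaurentZ (Hecke b) (invert a) := rfl

/-- The bar involution of the Hecke algebra as a ring endomorphism: `q ↦ q⁻¹`,
`H_k ↦ H_k⁻¹`. -/
def barHeckeHom (b : P.Base) : Hecke b →+* Hecke b :=
  (Hecke.lift b (B := HeckeTwist b) (fun k => (↑(Hecke.genUnit b k)⁻¹ : Hecke b))
    (by
      intro k
      have h := (Hecke.genUnit b k).inv_mul
      have h3 : (↑(Hecke.genUnit b k)⁻¹ : Hecke b) =
        Hecke.gen b k + algebraMap LaurentZ _ (T 1 - T (-1)) := rfl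
      have key : ((↑(Hecke.genUnit b k)⁻¹ : Hecke b) - algebraMap LaurentZ (Hecke b) (T 1)) *
          ((↑(Hecke.genUnit b k)⁻¹ : Hecke b) + algebraMap LaurentZ (Hecke b) (T (-1))) = 0 := by
        rw [h3, ← Hecke.quad b k, map_sub]
        congr 1 <;> abel
      have e1 : (algebraMap LaurentZ (HeckeTwist b) (T (-1)) : Hecke b) =
          algebraMap LaurentZ (Hecke b) (T 1) := by
        rw [HeckeTwist.algebraMap_eq, invert_T, neg_neg]
      have e2 : (algebraMap LaurentZ (HeckeTwist b) (T 1) : Hecke b) =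
          algebraMap LaurentZ (Hecke b) (T (-1)) := by
        rw [HeckeTwist.algebraMap_eq, invert_T]
      rw [← e1, ← e2] at key
      exact key)
    (by
      intro k l hkl
      have h : braidWord (Hecke.genUnit b k) (Hecke.genUnit b l) (coxeterOrder b k l) =
          braidWord (Hecke.genUnit b l) (Hecke.genUnit b k) (coxeterOrder b k l) := by
        apply Units.ext
        have := Hecke.braid b k l hkl
        rw [← Units.coeHom_apply, ← Units.coeHom_apply, map_braidWord, map_braidWord]
        exact this
      have h2 := congrArg (Units.coeHom (Hecke b)) (braidWord_inv_comm _ _ _ h)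
      rw [map_braidWord, map_braidWord] at h2
      exact h2)).toRingHom

lemma barHeckeHom_gen (b : P.Base) (k : b.support) :
    barHeckeHom b (Hecke.gen b k) = ↑(Hecke.genUnit b k)⁻¹ :=
  Hecke.lift_gen b (B := HeckeTwist b) _ _ _ k

lemma barHeckeHom_algebraMap (b : P.Base) (a : LaurentZ) :
    barHeckeHom b (algebraMap LaurentZ _ a) = algebraMap LaurentZ _ (invert a) :=
  AlgHom.commutes (B := HeckeTwist b) _ a

lemma invert_invert (a : LaurentZ) : (invert (invert a : LaurentZ) : LaurentZ) = a := by
  ext n; simp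

lemma barHeckeHom_barHeckeHom (b : P.Base) (h : Hecke b) :
    barHeckeHom b (barHeckeHom b h) = h := by
  let f : Hecke b →ₐ[LaurentZ] Hecke b :=
    { (barHeckeHom b).comp (barHeckeHom b) with
      commutes' := fun a => by
        change barHeckeHom b (barHeckeHom b _) = _
        rw [barHeckeHom_algebraMap, barHeckeHom_algebraMap, invert_invert] }
  have hf : f = AlgHom.id LaurentZ (Hecke b) := by
    apply Hecke.hom_ext
    intro k
    change barHeckeHom b (barHeckeHom b (Hecke.gen b k)) = Hecke.gen b k
    rw [barHeckeHom_gen]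
    change barHeckeHom b (Hecke.gen b k + algebraMap LaurentZ _ (T 1 - T (-1))) = _
    rw [map_add, barHeckeHom_gen, barHeckeHom_algebraMap]
    change Hecke.gen b k + algebraMap LaurentZ _ (T 1 - T (-1)) + _ = _
    rw [add_assoc, ← map_add]
    simp
  exact DFunLike.congr_fun hf h

/-- The bar involution of the Hecke algebra: the ring automorphism with `q ↦ q⁻¹` and
`H_k ↦ H_k⁻¹`. -/
def barHecke (b : P.Base) : Hecke b ≃+* Hecke b :=
  RingEquiv.ofRingHom (barHeckeHom b) (barHeckeHom b)
    (RingHom.ext (barHeckeHom_barHeckeHom b)) (RingHom.ext (barHeckeHom_barHeckeHom b))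

variable [CharZero R]

/-- Half the sum of the positive roots. -/
def rho (b : P.Base) : M :=
  (2⁻¹ : R) • ∑ᶠ i ∈ {i | b.IsPos i}, P.root i

/-- A finite set of integral weights, stable under the dot action `w · x = w (x + ρ) - ρ` of the
Weyl group and containing a regular orbit. -/
structure WeightSet (b : P.Base) where
  carrier : Finset M
  integral : ∀ x ∈ carrier, x ∈ weightLattice P
  dot_mem : ∀ (w : P.weylGroup), ∀ x ∈ carrier, w • (x + rho b) - rho b ∈ carrier
  exists_regular : ∃ x ∈ carrier, ∀ w : P.weylGroup, w • (x + rho b) = x + rho b → w = 1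

variable {b : P.Base}

/-- The `ρ`-shifted set of weights `{x + ρ}`, on which the Weyl group acts linearly. -/
def WeightSet.Shifted (X : WeightSet b) : Type _ := {i : M // i - rho b ∈ X.carrier}

/-- The action `i ↦ i s_k = s_k (i)` of a simple reflection on the shifted weights. -/
def WeightSet.reflect (X : WeightSet b) (k : b.support) (i : X.Shifted) : X.Shifted :=
  ⟨P.reflection k i.1, by
    have := X.dot_mem (RootPairing.weylGroup.ofIdx P k) _ i.2
    rwa [sub_add_cancel] at this⟩

/-- The free `ℤ[q, q⁻¹]`-module with basis `v_i` indexed by the shifted weights. -/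
def WeightSet.TMod (X : WeightSet b) : Type _ := X.Shifted →₀ LaurentZ

instance (X : WeightSet b) : AddCommGroup X.TMod :=
  inferInstanceAs (AddCommGroup (X.Shifted →₀ LaurentZ))

instance (X : WeightSet b) : Module LaurentZ X.TMod :=
  inferInstanceAs (Module LaurentZ (X.Shifted →₀ LaurentZ))

/-- The standard basis `v_i`. -/
def WeightSet.basis (X : WeightSet b) : Module.Basis X.Shifted LaurentZ X.TMod :=
  Finsupp.basisSingleOne

open Classical in
/-- The right action of `H_k`: `v_i H_k` is `q⁻¹ v_i` if `i s_k = i`, `v_{i s_k}` if `i s_k ≻ i`,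
and `v_{i s_k} + (q⁻¹ - q) v_i` if `i s_k ≺ i` (these cases are exhaustive). -/
def WeightSet.genAct (X : WeightSet b) (k : b.support) : X.TMod →ₗ[LaurentZ] X.TMod :=
  X.basis.constr LaurentZ fun i =>
    if X.reflect k i = i then (T (-1) : LaurentZ) • X.basis i
    else if WeightLT b i.1 (X.reflect k i).1 then X.basis (X.reflect k i)
    else X.basis (X.reflect k i) + (T (-1) - T 1 : LaurentZ) • X.basis i

section Facts

variable [Finite ι] [P.IsCrystallographic] [P.IsReduced]

lemma rho_pairing (b : P.Base) (k : b.support) :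
    P.toLinearMap (rho b) (P.coroot k) = 1 := by
  classical
  have := Fintype.ofFinite ι
  have hS : (∑ᶠ i ∈ {i | b.IsPos i}, P.root i) = ∑ i with b.IsPos i, P.root i := by
    rw [finsum_mem_eq_finite_toFinset_sum _ (Set.toFinite _)]
    congr 1; ext; simp
  set S := ∑ i with b.IsPos i, P.root i with hSdef
  have hk : (k : ι) ∈ Finset.univ.filter (fun i => b.IsPos i) := by
    simpa using RootPairing.Base.isPos_of_mem_support k.2
  have h1 : S = P.root k + ∑ i ∈ (Finset.univ.filter (fun i => b.IsPos i)).erase k, P.root i :=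
    (Finset.add_sum_erase _ _ hk).symm
  have h2 : P.reflection k (∑ i ∈ (Finset.univ.filter (fun i => b.IsPos i)).erase k, P.root i) =
      ∑ i ∈ (Finset.univ.filter (fun i => b.IsPos i)).erase k, P.root i := by
    rw [map_sum]
    have hmem : ∀ i ∈ (Finset.univ.filter (fun i => b.IsPos i)).erase (k : ι),
        P.reflectionPerm k i ∈ (Finset.univ.filter (fun i => b.IsPos i)).erase (k : ι) := by
      intro i hi
      simp only [Finset.mem_erase, Finset.mem_filter, Finset.mem_univ, true_and] at hi ⊢
      refine ⟨fun h => ?_, hi.2.reflectionPerm k.2 hi.1⟩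
      have hp := hi.2.reflectionPerm k.2 hi.1
      have h' : P.root i = -P.root k := by
        have := congrArg (fun j => P.root (P.reflectionPerm k j)) h
        simpa using this
      have hpos := hi.2
      have hkp := RootPairing.Base.isPos_of_mem_support (b := b) k.2
      have h4 : b.height i = - b.height k := by
        have := b.height_add_zsmul (i := k) (j := k) (k := i) (z := -2)
          (by rw [h']; module)
        rw [this]; ring
      rw [RootPairing.Base.isPos_iff] at hpos hkp
      omega
    refine Finset.sum_bij' (fun i _ => P.reflectionPerm k i) (fun i _ => P.reflectionPerm k i)
      hmem hmem ?_ ?_ ?_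
    · intro i _; simp
    · intro i _; simp
    · intro i _; simp
  have h3 : P.reflection k S = S - (2 : R) • P.root k := by
    rw [h1, map_add, h2, RootPairing.reflection_apply_self]; module
  rw [RootPairing.reflection_apply] at h3
  have h4 : P.coroot' k S = 2 := by
    have h5 : (P.coroot' k S - 2) • P.root k = 0 := by
      rw [sub_smul, sub_eq_zero]; exact sub_right_injective h3
    rcases smul_eq_zero.mp h5 with h | h
    · exact sub_eq_zero.mp h
    · exact absurd h (P.ne_zero _)
  have h6 : P.toLinearMap S (P.coroot k) = 2 := h4
  rw [rho, hS, map_smul, LinearMap.smul_apply, h6]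
  simp

lemma WeightSet.exists_int (X : WeightSet b) (i : X.Shifted) (k : b.support) :
    ∃ n : ℤ, P.toLinearMap i.1 (P.coroot k) = n := by
  obtain ⟨n, hn⟩ := X.integral _ i.2 k
  refine ⟨n + 1, ?_⟩
  rw [map_sub, LinearMap.sub_apply, rho_pairing] at hn
  push_cast
  rw [← hn]; ring

/-- The sum of the coefficients with respect to the simple roots. -/
def heightFun [P.IsRootSystem] (b : P.Base) : M →ₗ[R] R :=
  b.toWeightBasis.constr R fun _ => 1

lemma heightFun_of_mem [P.IsRootSystem] {x : M}
    (hx : x ∈ AddSubmonoid.closure (P.root '' b.support)) :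
    ∃ n : ℕ, heightFun b x = n ∧ (n = 0 → x = 0) := by
  induction hx using AddSubmonoid.closure_induction with
  | mem x hx =>
    obtain ⟨k, hk, rfl⟩ := hx
    refine ⟨1, ?_, by simp⟩
    have := b.toWeightBasis.constr_basis R (fun _ => (1 : R)) ⟨k, hk⟩
    rw [RootPairing.Base.toWeightBasis_apply] at this
    simpa [heightFun] using this
  | zero => exact ⟨0, by simp, by simp⟩
  | add x y _ _ hx hy =>
    obtain ⟨n, hn, hn'⟩ := hx
    obtain ⟨m, hm, hm'⟩ := hy
    refine ⟨n + m, by simp [hn, hm], fun h => ?_⟩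
    rw [hn' (by omega), hm' (by omega), add_zero]

lemma not_mem_closure_neg [P.IsRootSystem] {x : M}
    (hx : x ∈ AddSubmonoid.closure (P.root '' b.support))
    (hx' : -x ∈ AddSubmonoid.closure (P.root '' b.support)) : x = 0 := by
  obtain ⟨n, hn, hn'⟩ := heightFun_of_mem hx
  obtain ⟨m, hm, hm'⟩ := heightFun_of_mem hx'
  rw [map_neg, hn] at hm
  have : ((n + m : ℕ) : R) = 0 := by push_cast; rw [← hm]; ring
  have : n + m = 0 := by exact_mod_cast this
  exact hn' (by omega)

lemma WeightSet.reflect_val (X : WeightSet b) (k : b.support) (i : X.Shifted) {n : ℤ}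
    (hn : P.toLinearMap i.1 (P.coroot k) = n) :
    (X.reflect k i).1 = i.1 - (n : R) • P.root k := by
  change P.reflection k i.1 = _
  rw [RootPairing.reflection_apply, ← hn]; rfl

lemma WeightSet.reflect_eq_self (X : WeightSet b) (k : b.support) (i : X.Shifted)
    (hn : P.toLinearMap i.1 (P.coroot k) = (0 : ℤ)) : X.reflect k i = i := by
  apply Subtype.ext
  rw [X.reflect_val k i hn]; simp

lemma WeightSet.reflect_ne_self (X : WeightSet b) (k : b.support) (i : X.Shifted) {n : ℤ}
    (hn : P.toLinearMap i.1 (P.coroot k) = n) (h0 : n ≠ 0) : X.reflect k i ≠ i := by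
  intro h
  have h1 := X.reflect_val k i hn
  rw [h, eq_comm, sub_eq_self, smul_eq_zero] at h1
  rcases h1 with h1 | h1
  · exact h0 (by exact_mod_cast h1)
  · exact P.ne_zero _ h1

@[simp] lemma WeightSet.reflect_reflect (X : WeightSet b) (k : b.support) (i : X.Shifted) :
    X.reflect k (X.reflect k i) = i :=
  Subtype.ext (P.reflection_same k i.1)

lemma nsmul_root_mem (b : P.Base) (k : b.support) (n : ℕ) :
    (n : R) • P.root k ∈ AddSubmonoid.closure (P.root '' b.support) := by
  rw [Nat.cast_smul_eq_nsmul]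
  exact nsmul_mem (AddSubmonoid.subset_closure (Set.mem_image_of_mem _ k.2)) n

lemma WeightSet.lt_reflect (X : WeightSet b) (k : b.support) (i : X.Shifted) {n : ℤ}
    (hn : P.toLinearMap i.1 (P.coroot k) = n) (h0 : n < 0) :
    WeightLT b i.1 (X.reflect k i).1 := by
  refine ⟨?_, fun h => X.reflect_ne_self k i hn h0.ne (Subtype.ext h.symm)⟩
  rw [WeightLE, X.reflect_val k i hn]
  obtain ⟨m, hm⟩ := Int.eq_ofNat_of_zero_le (a := -n) (by omega)
  have := nsmul_root_mem b k m
  have h2 : (n : R) = -(m : R) := by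
    rw [← Int.cast_natCast, ← hm]; simp
  rw [h2]
  simpa using this

lemma WeightSet.genAct_fix (X : WeightSet b) (k : b.support) (i : X.Shifted)
    (hn : P.toLinearMap i.1 (P.coroot k) = (0 : ℤ)) :
    X.genAct k (X.basis i) = (T (-1) : LaurentZ) • X.basis i := by
  rw [genAct, Module.Basis.constr_basis, if_pos (X.reflect_eq_self k i hn)]

lemma WeightSet.genAct_up (X : WeightSet b) (k : b.support) (i : X.Shifted) {n : ℤ}
    (hn : P.toLinearMap i.1 (P.coroot k) = n) (h0 : n < 0) :
    X.genAct k (X.basis i) = X.basis (X.reflect k i) := by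
  rw [genAct, Module.Basis.constr_basis, if_neg (X.reflect_ne_self k i hn h0.ne),
    if_pos (X.lt_reflect k i hn h0)]

lemma WeightSet.pairing_reflect (X : WeightSet b) (k l : b.support) (i : X.Shifted) {n c A : ℤ}
    (hn : P.toLinearMap i.1 (P.coroot k) = n) (hc : P.toLinearMap i.1 (P.coroot l) = c)
    (hA : P.pairing k l = A) :
    P.toLinearMap (X.reflect k i).1 (P.coroot l) = (c - n * A : ℤ) := by
  rw [X.reflect_val k i hn, map_sub, LinearMap.sub_apply, hc, map_smul, LinearMap.smul_apply,
    RootPairing.root_coroot_eq_pairing, hA]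
  push_cast; rfl

lemma WeightSet.pairing_reflect_self (X : WeightSet b) (k : b.support) (i : X.Shifted) {n : ℤ}
    (hn : P.toLinearMap i.1 (P.coroot k) = n) :
    P.toLinearMap (X.reflect k i).1 (P.coroot k) = (-n : ℤ) := by
  have := X.pairing_reflect k k i (A := 2) hn hn (by simp)
  rw [this]; congr 1; ring

lemma WeightSet.genAct_down [P.IsRootSystem] (X : WeightSet b) (k : b.support) (i : X.Shifted)
    {n : ℤ} (hn : P.toLinearMap i.1 (P.coroot k) = n) (h0 : 0 < n) :
    X.genAct k (X.basis i) =
      X.basis (X.reflect k i) + (T (-1) - T 1 : LaurentZ) • X.basis i := by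
  rw [genAct, Module.Basis.constr_basis, if_neg (X.reflect_ne_self k i hn h0.ne'), if_neg]
  intro h
  have h' := X.lt_reflect k (X.reflect k i) (X.pairing_reflect_self k i hn) (by omega)
  rw [reflect_reflect] at h'
  have h1 := h.1
  have h2 := h'.1
  rw [WeightLE] at h1 h2
  rw [← neg_sub] at h2
  exact h.2 (sub_eq_zero.mp (not_mem_closure_neg h1 h2)).symm

lemma WeightSet.genAct_quad [P.IsRootSystem] (X : WeightSet b) (k : b.support) (v : X.TMod) :
    X.genAct k (X.genAct k v) = (T (-1) - T 1 : LaurentZ) • X.genAct k v + v := by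
  suffices X.genAct k ∘ₗ X.genAct k =
      (T (-1) - T 1 : LaurentZ) • X.genAct k + LinearMap.id from LinearMap.congr_fun this v
  refine X.basis.ext fun i => ?_
  simp only [LinearMap.comp_apply, LinearMap.add_apply, LinearMap.smul_apply, LinearMap.id_apply]
  obtain ⟨n, hn⟩ := X.exists_int i k
  have hn' := X.pairing_reflect_self k i hn
  rcases lt_trichotomy n 0 with h | rfl | h
  · rw [X.genAct_up k i hn h, X.genAct_down k _ hn' (by omega), reflect_reflect, add_comm]
  · rw [X.genAct_fix k i hn, map_smul, X.genAct_fix k i hn, smul_smul, smul_smul]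
    nth_rw 3 [← one_smul LaurentZ (X.basis i)]
    rw [← add_smul, sub_mul, ← T_add, ← T_add]
    simp
  · rw [X.genAct_down k i hn h, map_add, map_smul, X.genAct_up k _ hn' (by omega),
      reflect_reflect, X.genAct_down k i hn h, add_comm]

lemma coxeterOrder_eq (b : P.Base) (k l : b.support) :
    coxeterOrder b k l = orderOf (P.reflection k * P.reflection l) := by
  have h := orderOf_injective ((RootPairing.Equiv.weightHom P).comp P.weylGroup.subtype)
    ((RootPairing.Equiv.weightHom_injective P).comp Subtype.val_injective)
    (RootPairing.weylGroup.ofIdx P k * RootPairing.weylGroup.ofIdx P l)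
  rw [coxeterOrder, ← h, map_mul]
  have h1 : ∀ i : ι, ((RootPairing.Equiv.weightHom P).comp P.weylGroup.subtype)
      (RootPairing.weylGroup.ofIdx P i) = P.reflection i := fun i =>
    RootPairing.Equiv.reflection_weightEquiv P i
  rw [h1, h1]

lemma coxeterOrder_comm (b : P.Base) (k l : b.support) :
    coxeterOrder b k l = coxeterOrder b l k := by
  rw [coxeterOrder_eq, coxeterOrder_eq, ← orderOf_inv, mul_inv_rev, RootPairing.reflection_inv,
    RootPairing.reflection_inv]

lemma reflection_apply_lin (k : b.support) (x : M) {c : R}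
    (hx : P.toLinearMap x (P.coroot k) = c) : P.reflection k x = x - c • P.root k := by
  rw [RootPairing.reflection_apply, ← hx]; rfl

lemma reflection_comb (k l : b.support) (x : M) (y z : R) {a c : R} {A B : ℤ}
    (ha : P.toLinearMap x (P.coroot k) = a) (hc : P.toLinearMap x (P.coroot l) = c)
    (hA : P.pairing k l = A) (hB : P.pairing l k = B) :
    (P.reflection k * P.reflection l) (x + y • P.root k + z • P.root l) =
      x + (-(a + y) - ((-c - z - y * A) * B)) • P.root k + (-c - z - y * A) • P.root l := by
  have h1 : P.toLinearMap (x + y • P.root k + z • P.root l) (P.coroot l) = c + y * A + z * 2 := by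
    simp [hc, hA]
  rw [LinearEquiv.mul_apply, reflection_apply_lin l _ h1]
  have h2 : P.toLinearMap (x + y • P.root k + z • P.root l - (c + y * A + z * 2) • P.root l)
      (P.coroot k) = a + y * 2 + (z - (c + y * A + z * 2)) * B := by
    simp [ha, hB]; ring
  rw [reflection_apply_lin k _ h2]
  module

lemma coxeterOrder_cases [P.IsRootSystem] (b : P.Base) (k l : b.support) (hkl : k ≠ l) {A B : ℤ}
    (hA : P.pairing k l = A) (hB : P.pairing l k = B) :
    (A = 0 ∧ B = 0 → coxeterOrder b k l = 2) ∧ (A = -1 ∧ B = -1 → coxeterOrder b k l = 3) ∧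
    (A = -1 ∧ B = -2 → coxeterOrder b k l = 4) ∧ (A = -1 ∧ B = -3 → coxeterOrder b k l = 6) := by
  have hli := b.linearIndependent_pair_of_ne hkl
  rw [LinearIndependent.pair_iff] at hli
  have step := fun (x : M) (y z : R) => reflection_comb (P := P) k l x y z rfl rfl hA hB
  have start : ∀ x : M, x = x + (0 : R) • P.root k + (0 : R) • P.root l := fun x => by simp
  have hkk : P.toLinearMap (P.root k) (P.coroot k) = 2 := P.root_coroot_two k
  have hne : ∀ g : M ≃ₗ[R] M, ∀ y z : R, y ≠ 0 ∨ z ≠ 0 →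
      g (P.root k) = P.root k + y • P.root k + z • P.root l → g ≠ 1 := by
    rintro g y z h0 h rfl
    rw [LinearEquiv.coe_one, id_eq, add_assoc, left_eq_add] at h
    have := hli _ _ h
    tauto
  have hkl' : P.toLinearMap (P.root k) (P.coroot l) = A := hA
  simp only [coxeterOrder_eq]
  refine ⟨?_, ?_, ?_, ?_⟩
  · rintro ⟨rfl, rfl⟩
    refine orderOf_eq_prime ?_ ?_
    · ext x
      rw [start x]
      simp only [pow_succ, pow_zero, one_mul, LinearEquiv.mul_apply (_ * _) (_ * _), step]
      simp
    · refine hne _ (-2) 0 (by simp) ?_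
      nth_rw 1 [start (P.root k)]
      rw [step, hkk, hkl']
      push_cast; module
  · rintro ⟨rfl, rfl⟩
    refine orderOf_eq_prime ?_ ?_
    · ext x
      rw [start x]
      simp only [pow_succ, pow_zero, one_mul, LinearEquiv.mul_apply (_ * _) (_ * _), step]
      push_cast; simp only [LinearEquiv.coe_one, id_eq]; module
    · refine hne _ (-1) 1 (by simp) ?_
      nth_rw 1 [start (P.root k)]
      rw [step, hkk, hkl']
      push_cast; module
  · rintro ⟨rfl, rfl⟩
    refine orderOf_eq_of_pow_and_pow_div_prime (by norm_num) ?_ fun p hp hd => ?_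
    · ext x
      rw [start x]
      simp only [pow_succ, pow_zero, one_mul, LinearEquiv.mul_apply (_ * _) (_ * _), step]
      push_cast; simp only [LinearEquiv.coe_one, id_eq]; module
    · obtain rfl : p = 2 := (Nat.prime_dvd_prime_iff_eq hp Nat.prime_two).mp
        (hp.dvd_of_dvd_pow (show p ∣ 2 ^ 2 from hd))
      refine hne _ (-2) (0) (by simp) ?_
      nth_rw 1 [start (P.root k)]
      simp only [pow_succ, pow_zero, one_mul, LinearEquiv.mul_apply (_ * _) (_ * _), step, hkk, hkl']
      push_cast; module
  · rintro ⟨rfl, rfl⟩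
    refine orderOf_eq_of_pow_and_pow_div_prime (by norm_num) ?_ fun p hp hd => ?_
    · ext x
      rw [start x]
      simp only [pow_succ, pow_zero, one_mul, LinearEquiv.mul_apply (_ * _) (_ * _), step]
      push_cast; simp only [LinearEquiv.coe_one, id_eq]; module
    · rcases (hp.dvd_mul).mp (show p ∣ 2 * 3 from hd) with h | h
      · obtain rfl : p = 2 := (Nat.prime_dvd_prime_iff_eq hp Nat.prime_two).mp h
        refine hne _ (-2) (0) (by simp) ?_
        nth_rw 1 [start (P.root k)]
        simp only [pow_succ, pow_zero, one_mul, LinearEquiv.mul_apply (_ * _) (_ * _), step, hkk, hkl']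
        push_cast; module
      · obtain rfl : p = 3 := (Nat.prime_dvd_prime_iff_eq hp Nat.prime_three).mp h
        refine hne _ (0) (1) (by simp) ?_
        nth_rw 1 [start (P.root k)]
        simp only [pow_succ, pow_zero, one_mul, LinearEquiv.mul_apply (_ * _) (_ * _), step, hkk, hkl']
        push_cast; module

lemma braidWord_eq_pow_mul {G : Type*} [Group G] (n : ℕ) (s t : G) (hs : s * s = 1)
    (ht : t * t = 1) : braidWord s t n = (s * t) ^ n * braidWord t s n := by
  induction n generalizing s t with
  | zero => simp [braidWord]
  | succ n ih =>
    have h0 : SemiconjBy s (s * t) (t * s) := by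
      rw [SemiconjBy, ← mul_assoc, hs, one_mul, mul_assoc, hs, mul_one]
    have h1 : s * (s * t) ^ n = (t * s) ^ n * s := (h0.pow_right n).eq
    have h2 : (s * t) ^ n * (t * s) ^ n = 1 := by
      have h3 : t * s = (s * t)⁻¹ := by
        rw [eq_inv_iff_mul_eq_one, mul_assoc, ← mul_assoc s, hs, one_mul, ht]
      rw [h3, inv_pow, mul_inv_cancel]
    calc braidWord s t (n + 1) = s * braidWord t s n := rfl
      _ = (s * t) ^ n * (t * s) ^ n * s * braidWord t s n := by rw [h2, one_mul]
      _ = (s * t) ^ n * (s * ((s * t) ^ n * braidWord t s n)) := by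
        rw [← mul_assoc s, h1]; simp only [mul_assoc]
      _ = (s * t) ^ n * (s * (t * t) * braidWord s t n) := by rw [← ih s t hs ht, ht, mul_one]
      _ = (s * t) ^ (n + 1) * braidWord t s (n + 1) := by
        rw [pow_succ, braidWord]; simp only [mul_assoc]

lemma braidWord_comm_of_pow {G : Type*} [Group G] (n : ℕ) (s t : G) (hs : s * s = 1)
    (ht : t * t = 1) (h : (s * t) ^ n = 1) : braidWord s t n = braidWord t s n := by
  rw [braidWord_eq_pow_mul n s t hs ht, h, one_mul]

/-- The right action of the alternating word in `H_k`, `H_l` with `n` letters. -/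
def WeightSet.wordAct (X : WeightSet b) (k l : b.support) (n : ℕ) : X.TMod →ₗ[LaurentZ] X.TMod :=
  (braidWord (MulOpposite.op (X.genAct k : Module.End LaurentZ X.TMod))
    (MulOpposite.op (X.genAct l : Module.End LaurentZ X.TMod)) n).unop

lemma WeightSet.wordAct_zero (X : WeightSet b) (k l : b.support) (v : X.TMod) :
    X.wordAct k l 0 v = v := rfl

lemma WeightSet.wordAct_succ (X : WeightSet b) (k l : b.support) (n : ℕ) (v : X.TMod) :
    X.wordAct k l (n + 1) v = X.wordAct l k n (X.genAct k v) := rfl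

lemma WeightSet.wordAct_snoc (X : WeightSet b) (k l : b.support) (n : ℕ) (v : X.TMod) :
    X.wordAct k l (n + 1) v = X.genAct (if Even n then k else l) (X.wordAct k l n v) := by
  rw [wordAct, braidWord_snoc]
  by_cases h : Even n <;> simp [h, wordAct]

lemma WeightSet.wordAct_stable [P.IsRootSystem] (X : WeightSet b) (k l : b.support) (n : ℕ)
    (v : X.TMod) (h : X.wordAct k l n v = X.wordAct l k n v) :
    X.wordAct k l n (X.genAct k v) = X.wordAct l k n (X.genAct k v) := by
  cases n with
  | zero => rfl
  | succ n =>
    rw [wordAct_succ, genAct_quad, map_add, map_smul, ← wordAct_succ, ← wordAct_succ,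
      wordAct_snoc X k l (n + 1), h, wordAct_snoc X l k n]
    have : (if Even (n + 1) then k else l) = (if Even n then l else k) := by
      by_cases hn : Even n <;> simp [hn, Nat.even_add_one]
    rw [this, genAct_quad]

/-- The endpoint `i s_k s_l s_k ⋯` with `n` letters. -/
def WeightSet.walk (X : WeightSet b) (k l : b.support) : ℕ → X.Shifted → X.Shifted
  | 0, i => i
  | n + 1, i => WeightSet.walk X l k n (X.reflect k i)

lemma WeightSet.walk_val (X : WeightSet b) (k l : b.support) (n : ℕ) (i : X.Shifted) :
    (X.walk k l n i).1 = (braidWord (P.reflection k) (P.reflection l) n)⁻¹ i.1 := by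
  induction n generalizing k l i with
  | zero => simp [walk, braidWord]
  | succ n ih =>
    rw [walk, ih, braidWord, mul_inv_rev, LinearEquiv.mul_apply, RootPairing.reflection_inv]
    rfl

lemma WeightSet.walk_comm (X : WeightSet b) (k l : b.support) (i : X.Shifted) :
    X.walk k l (coxeterOrder b k l) i = X.walk l k (coxeterOrder b k l) i := by
  apply Subtype.ext
  rw [walk_val, walk_val, braidWord_comm_of_pow]
  · rw [← sq, RootPairing.reflection_sq]
  · rw [← sq, RootPairing.reflection_sq]
  · rw [coxeterOrder_eq, pow_orderOf_eq_one]

/-- All `n` steps of the alternating walk are weakly ascending; `a`, `c` are the current pairings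
and `A`, `B` the Cartan integers. -/
def ascending : ℕ → ℤ → ℤ → ℤ → ℤ → Prop
  | 0, _, _, _, _ => True
  | n + 1, A, B, a, c => a ≤ 0 ∧ ascending n B A (c - a * A) (-a)

/-- The number of steps of the alternating walk which do not move. -/
def stalls : ℕ → ℤ → ℤ → ℤ → ℤ → ℕ
  | 0, _, _, _, _ => 0
  | n + 1, A, B, a, c => stalls n B A (c - a * A) (-a) + (if a = 0 then 1 else 0)

lemma WeightSet.wordAct_of_ascending (X : WeightSet b) (k l : b.support) (n : ℕ) (i : X.Shifted)
    {A B a c : ℤ} (hA : P.pairing k l = A) (hB : P.pairing l k = B)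
    (ha : P.toLinearMap i.1 (P.coroot k) = a) (hc : P.toLinearMap i.1 (P.coroot l) = c)
    (h : ascending n A B a c) :
    X.wordAct k l n (X.basis i) =
      (T (-1) : LaurentZ) ^ stalls n A B a c • X.basis (X.walk k l n i) := by
  induction n generalizing k l i A B a c with
  | zero => simp [stalls, walk, wordAct_zero]
  | succ n ih =>
    obtain ⟨h0, h⟩ := h
    have h1 := ih l k (X.reflect k i) hB hA (X.pairing_reflect k l i ha hc hA)
      (X.pairing_reflect_self k i ha) h
    rw [wordAct_succ, stalls, walk]
    rcases h0.lt_or_eq with h0 | rfl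
    · rw [X.genAct_up k i ha h0, h1, if_neg h0.ne, add_zero]
    · rw [X.genAct_fix k i ha, map_smul]
      nth_rw 1 [← X.reflect_eq_self k i ha]
      rw [h1, if_pos rfl, pow_succ', mul_smul]

lemma WeightSet.braid_bottom [P.IsRootSystem] (X : WeightSet b) (k l : b.support) (hkl : k ≠ l)
    (i : X.Shifted) {a c : ℤ}
    (ha : P.toLinearMap i.1 (P.coroot k) = a) (hc : P.toLinearMap i.1 (P.coroot l) = c)
    (ha0 : a ≤ 0) (hc0 : c ≤ 0) :
    X.wordAct k l (coxeterOrder b k l) (X.basis i) =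
      X.wordAct l k (coxeterOrder b k l) (X.basis i) := by
  have hne : (k : ι) ≠ l := fun h => hkl (Subtype.ext h)
  have hmem := P.pairingIn_pairingIn_mem_set_of_isCrystal_of_isRed' k l
    (fun h => hne (P.root.injective h)) (b.root_ne_neg_of_ne k.2 l.2 hne)
  have hA0 := b.pairingIn_le_zero_of_ne hne k.2 l.2
  have hB0 := b.pairingIn_le_zero_of_ne hne.symm l.2 k.2
  have hA := P.algebraMap_pairingIn ℤ k l
  have hB := P.algebraMap_pairingIn ℤ l k
  generalize P.pairingIn ℤ k l = A at *
  generalize P.pairingIn ℤ l k = B at *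
  replace hA : P.pairing k l = (A : R) := by rw [← hA]; simp
  replace hB : P.pairing l k = (B : R) := by rw [← hB]; simp
  have o1 := coxeterOrder_cases b k l hkl hA hB
  have o2 := coxeterOrder_cases b l k hkl.symm hB hA
  rw [coxeterOrder_comm b l k] at o2
  suffices ascending (coxeterOrder b k l) A B a c ∧ ascending (coxeterOrder b k l) B A c a ∧
      stalls (coxeterOrder b k l) A B a c = stalls (coxeterOrder b k l) B A c a by
    obtain ⟨h1, h2, h3⟩ := this
    rw [X.wordAct_of_ascending k l _ i hA hB ha hc h1,
      X.wordAct_of_ascending l k _ i hB hA hc ha h2, h3, X.walk_comm]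
  simp only [Set.mem_insert_iff, Set.mem_singleton_iff, Prod.mk.injEq] at hmem
  have hcases : (A = 0 ∧ B = 0 ∧ coxeterOrder b k l = 2) ∨
      (A = -1 ∧ B = -1 ∧ coxeterOrder b k l = 3) ∨
      (A = -1 ∧ B = -2 ∧ coxeterOrder b k l = 4) ∨ (A = -2 ∧ B = -1 ∧ coxeterOrder b k l = 4) ∨
      (A = -1 ∧ B = -3 ∧ coxeterOrder b k l = 6) ∨ (A = -3 ∧ B = -1 ∧ coxeterOrder b k l = 6) := by
    clear hA hB ha hc
    rcases hmem with ⟨rfl, rfl⟩ | ⟨rfl, rfl⟩ | ⟨rfl, rfl⟩ | ⟨rfl, rfl⟩ | ⟨rfl, rfl⟩ | ⟨rfl, rfl⟩ |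
      ⟨rfl, rfl⟩ | ⟨rfl, rfl⟩ | ⟨rfl, rfl⟩ | ⟨rfl, rfl⟩ | ⟨rfl, rfl⟩ <;>
      simp at hA0 hB0 o1 o2 <;> simp [o1, o2]
  clear hA hB ha hc o1 o2 hmem
  rcases hcases with ⟨rfl, rfl, hm⟩ | ⟨rfl, rfl, hm⟩ | ⟨rfl, rfl, hm⟩ | ⟨rfl, rfl, hm⟩ |
    ⟨rfl, rfl, hm⟩ | ⟨rfl, rfl, hm⟩ <;> rw [hm] <;> clear hm <;>
    simp only [ascending, stalls, and_true] <;> refine ⟨by omega, by omega, ?_⟩ <;>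
    rcases ha0.lt_or_eq with ha1 | rfl <;> rcases hc0.lt_or_eq with hc1 | rfl <;>
    simp (disch := omega) only [if_neg, if_pos] <;> simp

lemma WeightLT.trans' {x y z : M} (h : WeightLT b x y) (h' : WeightLT b y z) [P.IsRootSystem] :
    WeightLT b x z := by
  have h1 : WeightLE b x z := by
    have := add_mem h.1 h'.1
    rwa [sub_add_sub_cancel'] at this
  refine ⟨h1, ?_⟩
  rintro rfl
  have h2 := h.1
  have h3 := h'.1
  rw [WeightLE] at h2 h3
  rw [← neg_sub] at h3
  exact h.2 (sub_eq_zero.mp (not_mem_closure_neg h2 h3)).symm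

instance (X : WeightSet b) : Finite X.Shifted :=
  Finite.of_injective (β := X.carrier) (fun i => ⟨i.1 - rho b, i.2⟩) fun i j h => by
    apply Subtype.ext
    simpa using h

lemma WeightSet.wf [P.IsRootSystem] (X : WeightSet b) :
    WellFounded fun i j : X.Shifted => WeightLT b i.1 j.1 := by
  have : IsTrans X.Shifted fun i j => WeightLT b i.1 j.1 := ⟨fun _ _ _ h h' => h.trans' h'⟩
  have : Std.Irrefl fun i j : X.Shifted => WeightLT b i.1 j.1 := ⟨fun _ h => h.2 rfl⟩
  exact Finite.wellFounded_of_trans_of_irrefl _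

lemma WeightSet.wordAct_comm [P.IsRootSystem] (X : WeightSet b) (k l : b.support) (hkl : k ≠ l) :
    X.wordAct k l (coxeterOrder b k l) = X.wordAct l k (coxeterOrder b k l) := by
  refine X.basis.ext fun i => ?_
  induction i using X.wf.induction with
  | _ i ih =>
    have low : ∀ (k : b.support) {n : ℤ}, P.toLinearMap i.1 (P.coroot k) = n → 0 < n →
        WeightLT b (X.reflect k i).1 i.1 ∧
          X.basis i = X.genAct k (X.basis (X.reflect k i)) := by
      intro k n hn h0
      have hn' := X.pairing_reflect_self k i hn
      have h1 := X.lt_reflect k _ hn' (by omega)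
      have h2 := X.genAct_up k _ hn' (by omega)
      rw [reflect_reflect] at h1 h2
      exact ⟨h1, h2.symm⟩
    obtain ⟨a, ha⟩ := X.exists_int i k
    obtain ⟨c, hc⟩ := X.exists_int i l
    rcases lt_or_ge 0 a with h | h
    · obtain ⟨h1, h2⟩ := low k ha h
      rw [h2]
      exact X.wordAct_stable k l _ _ (ih _ h1)
    rcases lt_or_ge 0 c with h' | h'
    · obtain ⟨h1, h2⟩ := low l hc h'
      rw [h2]
      exact (X.wordAct_stable l k _ _ (ih _ h1).symm).symm
    exact X.braid_bottom k l hkl i ha hc h h'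

/-- The right action of the Hecke algebra on `⊕ ℤ[q, q⁻¹] v_i`. -/
def WeightSet.rightAct [P.IsRootSystem] (X : WeightSet b) :
    (Hecke b)ᵐᵒᵖ →ₐ[LaurentZ] Module.End LaurentZ X.TMod :=
  AlgHom.opComm <| Hecke.lift b (B := (Module.End LaurentZ X.TMod)ᵐᵒᵖ)
    (fun k => MulOpposite.op (X.genAct k))
    (by
      intro k
      apply MulOpposite.unop_injective
      refine LinearMap.ext fun v => ?_
      have h := X.genAct_quad k v
      have h1 : (T 1 : LaurentZ) • (T (-1) : LaurentZ) • v = v := by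
        rw [smul_smul, ← T_add]; simp
      change X.genAct k (X.genAct k v - (T (-1) : LaurentZ) • v) +
        (T 1 : LaurentZ) • (X.genAct k v - (T (-1) : LaurentZ) • v) = 0
      rw [_root_.map_sub, _root_.map_smul, h, smul_sub, h1]
      module)
    (fun k l hkl => MulOpposite.unop_injective (X.wordAct_comm k l hkl))

/-- The right module structure over the Hecke algebra; `v · h` is `MulOpposite.op h • v`. -/
instance [P.IsRootSystem] (X : WeightSet b) : Module (Hecke b)ᵐᵒᵖ X.TMod :=
  Module.compHom X.TMod X.rightAct.toRingHom

lemma WeightSet.op_gen_smul [P.IsRootSystem] (X : WeightSet b) (k : b.support) (v : X.TMod) :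
    MulOpposite.op (Hecke.gen b k) • v = X.genAct k v := by
  have h : X.rightAct (MulOpposite.op (Hecke.gen b k)) = X.genAct k :=
    congrArg MulOpposite.unop
      (Hecke.lift_gen b (B := (Module.End LaurentZ X.TMod)ᵐᵒᵖ) _ _ _ k)
  exact LinearMap.congr_fun h v

lemma WeightSet.op_algebraMap_smul [P.IsRootSystem] (X : WeightSet b) (a : LaurentZ)
    (v : X.TMod) : MulOpposite.op (algebraMap LaurentZ (Hecke b) a) • v = a • v :=
  LinearMap.congr_fun (X.rightAct.commutes a) v

/-- The `q`-Schur algebra: the endomorphism algebra of the right Hecke module. -/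
abbrev WeightSet.Schur [P.IsRootSystem] (X : WeightSet b) : Type _ :=
  Module.End (Hecke b)ᵐᵒᵖ X.TMod

/-- The characterization of the bar involution on `⊕ ℤ[q, q⁻¹] v_i`: it is semilinear for
`q ↦ q⁻¹`, fixes `v_i` for `i` anti-dominant, and sends `v_i · h` to the product of the bars. -/
structure IsBarT [P.IsRootSystem] (X : WeightSet b) (β : X.TMod → X.TMod) : Prop where
  map_add : ∀ v w, β (v + w) = β v + β w
  map_smul : ∀ (a : LaurentZ) (v : X.TMod), β (a • v) = (invert a : LaurentZ) • β v
  fix : ∀ i : X.Shifted, IsAntidominant b i.1 → β (X.basis i) = X.basis i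
  act : ∀ (i : X.Shifted) (h : Hecke b),
    β (MulOpposite.op h • X.basis i) = MulOpposite.op (barHecke b h) • β (X.basis i)

/-- The defining property of the bar involution on the `q`-Schur algebra: for `i` anti-dominant,
the bar of `η` sends `v_i · h` to `(bar (η v_i)) · h`. -/
def IsBarS [P.IsRootSystem] (X : WeightSet b) (βT : X.TMod → X.TMod)
    (βS : X.Schur → X.Schur) : Prop :=
  ∀ (η : X.Schur) (i : X.Shifted), IsAntidominant b i.1 → ∀ h : Hecke b,
    βS η (MulOpposite.op h • X.basis i) = MulOpposite.op h • βT (η (X.basis i))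

end Facts

end Roots

end QSchur

end

noncomputable section

namespace QSchur

open LaurentPolynomial MulOpposite

variable {ι R M N : Type*} [Field R] [CharZero R] [AddCommGroup M] [Module R M]
  [AddCommGroup N] [Module R N] {P : RootPairing ι R M N} {b : P.Base}

/-! The crux is a presentation (`WeightSet.exists_hom`): as a right Hecke module, `X.TMod` is
generated by the `v_i` with `i` anti-dominant, subject only to `v_i H_k = q⁻¹ v_i` whenever `i s_k =
i`. Every orbit contributes an induced module, and a map out of it is a choice of images satisfying
these relations.

Both bar maps follow. The relations say that `H_k` acts on `v_i` by `q⁻¹`, equivalently that `H_k⁻¹`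
acts by `q`, so they are stable under bar. Hence `v_i ↦ v_i` extends to a Hecke-linear map into
`X.TMod` with bar-twisted action, which is the bar on `X.TMod`; and `v_i ↦ bar (η v_i)` extends to
an endomorphism, which is the bar of `η`. Uniqueness, involutivity and compatibility need only be
tested on the vectors `v_i h` with `i` anti-dominant, which span additively
(`WeightSet.antidominant_induction`).

To prove the presentation, images `φ i` are built upwards in the dominance order: `φ i = φ (i s_d)
H_d` for one chosen `d` with positive pairing (`WeightSet.exists_stepCompat`). The result must not
depend on `d`. Two candidates `k`, `l` are compared in the dihedral orbit of `i`
(`WeightSet.StepCompat.of_ne`): the two alternating walks of length `m_{kl}` down from `i` end at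
the same weight, and the braid relation identifies the two ways back up. Singular orbits contribute
powers of `q⁻¹`, counted by `stalls`; `ascending_and_stalls` shows that the two counts agree. -/

/-! ### Hecke algebra: induction principle, opposite braid relation, quadratic relation -/

lemma Hecke.induction (b : P.Base) {p : Hecke b → Prop}
    (scalar : ∀ a : LaurentZ, p (algebraMap LaurentZ _ a)) (gen : ∀ k, p (Hecke.gen b k))
    (add : ∀ x y, p x → p y → p (x + y)) (mul : ∀ x y, p x → p y → p (x * y)) (h : Hecke b) :
    p h := by
  obtain ⟨x, rfl⟩ := RingQuot.mkAlgHom_surjective LaurentZ (HeckeRel b) h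
  induction x using FreeAlgebra.induction with
  | grade0 a => rw [AlgHom.commutes]; exact scalar a
  | grade1 k => exact gen k
  | add x y hx hy => rw [map_add]; exact add _ _ hx hy
  | mul x y hx hy => rw [map_mul]; exact mul _ _ hx hy

/-- Read backwards, an alternating word keeps its first letter when its length is odd and starts
with the other letter when it is even. In both cases the braid relation survives passing to the
opposite algebra. -/
lemma op_braidWord {G : Type*} [Monoid G] (n : ℕ) (x y : G) :
    op (braidWord x y n) = if Even n then braidWord (op y) (op x) n
      else braidWord (op x) (op y) n := by
  induction n with
  | zero => simp [braidWord]
  | succ n ih =>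
    rw [braidWord_snoc, op_mul, ih]
    by_cases h : Even n <;> simp [h, Nat.even_add_one, braidWord]

lemma Hecke.braid_op (b : P.Base) (k l : b.support) (hkl : k ≠ l) :
    braidWord (op (Hecke.gen b k)) (op (Hecke.gen b l)) (coxeterOrder b k l) =
      braidWord (op (Hecke.gen b l)) (op (Hecke.gen b k)) (coxeterOrder b k l) := by
  have h := congrArg op (Hecke.braid b k l hkl)
  rw [op_braidWord, op_braidWord] at h
  split_ifs at h
  exacts [h.symm, h]

lemma Hecke.gen_mul_gen (b : P.Base) (k : b.support) :
    Hecke.gen b k * Hecke.gen b k =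
      algebraMap LaurentZ _ (T (-1) - T 1) * Hecke.gen b k + 1 := by
  have h := (Hecke.genUnit b k).inv_mul
  change (Hecke.gen b k + algebraMap LaurentZ _ (T 1 - T (-1))) * Hecke.gen b k = 1 at h
  rw [← h, add_mul, add_left_comm, ← add_mul, ← map_add]
  simp

/-! ### Descents in the dominance order and generation by anti-dominant vectors -/

section Presentation

variable [Finite ι] [P.IsCrystallographic] [P.IsReduced]

lemma WeightSet.reflect_lt (X : WeightSet b) (k : b.support) (i : X.Shifted) {n : ℤ}
    (hn : P.toLinearMap i.1 (P.coroot k) = n) (h0 : 0 < n) :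
    WeightLT b (X.reflect k i).1 i.1 := by
  have h := X.lt_reflect k _ (X.pairing_reflect_self k i hn) (by omega)
  rwa [reflect_reflect] at h

lemma WeightSet.basis_eq_gen_smul [P.IsRootSystem] (X : WeightSet b) (k : b.support)
    (i : X.Shifted) {n : ℤ} (hn : P.toLinearMap i.1 (P.coroot k) = n) (h0 : 0 < n) :
    X.basis i = op (Hecke.gen b k) • X.basis (X.reflect k i) := by
  rw [op_gen_smul, X.genAct_up k _ (X.pairing_reflect_self k i hn) (by omega), reflect_reflect]

lemma WeightSet.exists_pos (X : WeightSet b) (i : X.Shifted) (hi : ¬ IsAntidominant b i.1) :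
    ∃ (k : b.support) (n : ℤ), P.toLinearMap i.1 (P.coroot k) = n ∧ 0 < n := by
  by_contra! h
  refine hi fun k hk => ?_
  obtain ⟨n, hn⟩ := X.exists_int i ⟨k, hk⟩
  obtain ⟨m, hm⟩ := Int.eq_ofNat_of_zero_le (a := -n) (by have := h _ _ hn; omega)
  refine ⟨m, hn.trans ?_⟩
  rw [← Int.cast_natCast, ← hm]; simp

lemma IsAntidominant.nonpos {i : M} (hi : IsAntidominant b i) (k : b.support) {n : ℤ}
    (hn : P.toLinearMap i (P.coroot k) = n) : n ≤ 0 := by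
  obtain ⟨m, hm⟩ := hi k k.2
  have : (n : R) = ((-m : ℤ) : R) := by rw [← hn, hm]; simp
  have := Int.cast_injective this
  omega

lemma WeightSet.basis_induction (X : WeightSet b) {p : X.TMod → Prop} (zero : p 0)
    (add : ∀ v w, p v → p w → p (v + w)) (smul : ∀ (a : LaurentZ) i, p (a • X.basis i))
    (v : X.TMod) : p v := by
  have hv := X.basis.mem_span v
  induction hv using Submodule.closure_induction with
  | zero => exact zero
  | add v w _ _ hv hw => exact add v w hv hw
  | smul_mem a v hv =>
    obtain ⟨i, rfl⟩ := hv
    exact smul a i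

/-- The vectors `v_i · h` with `i` anti-dominant span `⊕ ℤ[q, q⁻¹] v_i` additively. -/
lemma WeightSet.antidominant_induction [P.IsRootSystem] (X : WeightSet b) {p : X.TMod → Prop}
    (add : ∀ v w, p v → p w → p (v + w))
    (smul : ∀ (i : X.Shifted) (h : Hecke b), IsAntidominant b i.1 → p (op h • X.basis i))
    (h0 : p 0) (v : X.TMod) : p v := by
  -- `h` stays universally quantified in the induction: each descent `v_i = v_{i s_k} H_k` is
  -- absorbed into it.
  have key : ∀ (i : X.Shifted) (h : Hecke b), p (op h • X.basis i) := by
    intro i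
    induction i using X.wf.induction with
    | _ i ih =>
      intro h
      by_cases hi : IsAntidominant b i.1
      · exact smul i h hi
      obtain ⟨k, n, hn, hpos⟩ := X.exists_pos i hi
      rw [X.basis_eq_gen_smul k i hn hpos, smul_smul, ← op_mul]
      exact ih _ (X.reflect_lt k i hn hpos) _
  induction v using X.basis_induction with
  | zero => exact h0
  | add v w hv hw => exact add v w hv hw
  | smul a i => rw [← X.op_algebraMap_smul]; exact key i _

/-! ### Walks in rank two orbits -/

/-- The alternating walk of length `m_{kl}` down from the top of a rank two orbit is weakly
descending, and it stalls exactly once if the starting point is singular. -/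
lemma ascending_and_stalls [P.IsRootSystem] (k l : b.support) (hkl : k ≠ l) {A B a c : ℤ}
    (hA : P.pairing k l = A) (hB : P.pairing l k = B) (ha : a < 0) (hc : c ≤ 0) :
    ascending (coxeterOrder b k l) A B a c ∧ ascending (coxeterOrder b k l) B A c a ∧
      stalls (coxeterOrder b k l) A B a c = (if c = 0 then 1 else 0) ∧
      stalls (coxeterOrder b k l) B A c a = (if c = 0 then 1 else 0) ∧
      2 ≤ coxeterOrder b k l := by
  have hne : (k : ι) ≠ l := fun h => hkl (Subtype.ext h)
  have hmem := P.pairingIn_pairingIn_mem_set_of_isCrystal_of_isRed' k l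
    (fun h => hne (P.root.injective h)) (b.root_ne_neg_of_ne k.2 l.2 hne)
  have hA0 := b.pairingIn_le_zero_of_ne hne k.2 l.2
  have hB0 := b.pairingIn_le_zero_of_ne hne.symm l.2 k.2
  obtain rfl : P.pairingIn ℤ k l = A := by
    have := P.algebraMap_pairingIn ℤ k l
    rw [hA] at this
    exact Int.cast_injective (α := R) (by simpa using this)
  obtain rfl : P.pairingIn ℤ l k = B := by
    have := P.algebraMap_pairingIn ℤ l k
    rw [hB] at this
    exact Int.cast_injective (α := R) (by simpa using this)
  have o1 := coxeterOrder_cases b k l hkl hA hB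
  have o2 := coxeterOrder_cases b l k hkl.symm hB hA
  rw [coxeterOrder_comm b l k] at o2
  clear hA hB
  generalize P.pairingIn ℤ k l = A at *
  generalize P.pairingIn ℤ l k = B at *
  simp only [Set.mem_insert_iff, Set.mem_singleton_iff, Prod.mk.injEq] at hmem
  -- Distinct simple roots have nonpositive Cartan integers, which leaves the types A₁×A₁, A₂, B₂
  -- and G₂, the last two in both orientations.
  have hcases : (A = 0 ∧ B = 0 ∧ coxeterOrder b k l = 2) ∨
      (A = -1 ∧ B = -1 ∧ coxeterOrder b k l = 3) ∨
      (A = -1 ∧ B = -2 ∧ coxeterOrder b k l = 4) ∨ (A = -2 ∧ B = -1 ∧ coxeterOrder b k l = 4) ∨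
      (A = -1 ∧ B = -3 ∧ coxeterOrder b k l = 6) ∨ (A = -3 ∧ B = -1 ∧ coxeterOrder b k l = 6) := by
    rcases hmem with ⟨rfl, rfl⟩ | ⟨rfl, rfl⟩ | ⟨rfl, rfl⟩ | ⟨rfl, rfl⟩ | ⟨rfl, rfl⟩ | ⟨rfl, rfl⟩ |
      ⟨rfl, rfl⟩ | ⟨rfl, rfl⟩ | ⟨rfl, rfl⟩ | ⟨rfl, rfl⟩ | ⟨rfl, rfl⟩ <;>
      simp at hA0 hB0 o1 o2 <;> simp [o1, o2]
  clear o1 o2 hmem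
  rcases hcases with ⟨rfl, rfl, hm⟩ | ⟨rfl, rfl, hm⟩ | ⟨rfl, rfl, hm⟩ | ⟨rfl, rfl, hm⟩ |
    ⟨rfl, rfl, hm⟩ | ⟨rfl, rfl, hm⟩ <;> rw [hm] <;> clear hm <;>
    simp only [ascending, stalls, and_true] <;>
    -- Since `a < 0` is strict, only `c` can make the orbit singular. When `c = 0`, the walk
    -- starting with `l` stalls at its first step and the walk starting with `k` at its last.
    refine ⟨by omega, by omega, ?_, ?_, by omega⟩ <;>
    rcases hc.lt_or_eq with hc1 | rfl <;>
    simp (disch := omega) only [if_neg, if_pos] <;> simp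

/-! ### Extending a family from anti-dominant weights -/

section Extension

variable {V : Type*} [AddCommGroup V] [Module (Hecke b)ᵐᵒᵖ V]

/-- For a family `φ` in a Hecke module, the step of `i` to `i s_k` is compatible with `H_k`. -/
def WeightSet.StepCompat (X : WeightSet b) (φ : X.Shifted → V) (i : X.Shifted)
    (k : b.support) : Prop :=
  ∀ n : ℤ, P.toLinearMap i.1 (P.coroot k) = n → 0 ≤ n →
    op (Hecke.gen b k) • φ (X.reflect k i) =
      op (algebraMap LaurentZ (Hecke b) (T (-1) ^ (if n = 0 then 1 else 0))) • φ i

/-- In the opposite algebra the last letter of the word acts first, so the word retraces the walk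
from its endpoint back up to `i`. Each moving step is undone exactly, and each stall costs a factor
`q⁻¹`. The pairings enter `ascending` and `stalls` negated because this walk descends. -/
lemma WeightSet.braidWord_smul_walk [P.IsRootSystem] (X : WeightSet b) (φ : X.Shifted → V)
    (k l : b.support) (n : ℕ) (i : X.Shifted) {A B a c : ℤ}
    (hA : P.pairing k l = A) (hB : P.pairing l k = B)
    (ha : P.toLinearMap i.1 (P.coroot k) = a) (hc : P.toLinearMap i.1 (P.coroot l) = c)
    (h : ascending n A B (-a) (-c))
    (hφ : ∀ j : X.Shifted, j = i ∨ WeightLT b j.1 i.1 → ∀ k, X.StepCompat φ j k) :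
    braidWord (op (Hecke.gen b k)) (op (Hecke.gen b l)) n • φ (X.walk k l n i) =
      op (algebraMap LaurentZ (Hecke b) (T (-1) ^ stalls n A B (-a) (-c))) • φ i := by
  induction n generalizing k l i A B a c with
  | zero => simp [stalls, walk, braidWord]
  | succ n ih =>
    obtain ⟨h0, h⟩ := h
    -- A step either stalls at `i` or goes strictly down, so compatibility at and below `i` covers
    -- the rest of the walk.
    have hlt : ∀ j : X.Shifted, j = X.reflect k i ∨ WeightLT b j.1 (X.reflect k i).1 →
        j = i ∨ WeightLT b j.1 i.1 := by
      rcases (show 0 ≤ a by omega).eq_or_lt with rfl | h1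
      · rw [X.reflect_eq_self k i ha]; exact fun j hj => hj
      · rintro j (rfl | hj)
        · exact .inr (X.reflect_lt k i ha h1)
        · exact .inr (hj.trans' (X.reflect_lt k i ha h1))
    have e1 : -c - -a * A = -(c - a * A) := by ring
    rw [e1] at h
    have h1 := ih l k (X.reflect k i) hB hA (X.pairing_reflect k l i ha hc hA)
      (X.pairing_reflect_self k i ha) h fun j hj => hφ j (hlt j hj)
    rw [braidWord, mul_smul, walk, h1, smul_smul, ← op_mul, Algebra.commutes, op_mul, mul_smul,
      hφ i (.inl rfl) k a ha (by omega), smul_smul, ← op_mul, ← map_mul, stalls, e1, pow_add,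
      mul_comm]
    simp only [neg_eq_zero]

/-- Independence of the chosen descent. Climbing back along the walk that starts with `k` yields `φ
i` up to a known power of `q⁻¹`; by the braid relation and the common endpoint, so does the walk
that starts with `l`. Stripping the final `H_l` from the latter climb leaves the compatibility in
direction `l`. -/
lemma WeightSet.StepCompat.of_ne [P.IsRootSystem] {X : WeightSet b} {φ : X.Shifted → V}
    {i : X.Shifted} {k l : b.support} (hkl : k ≠ l) {a : ℤ}
    (ha : P.toLinearMap i.1 (P.coroot k) = a) (ha0 : 0 < a) (hk : X.StepCompat φ i k)
    (hφ : ∀ j : X.Shifted, WeightLT b j.1 i.1 → ∀ k, X.StepCompat φ j k) :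
    X.StepCompat φ i l := by
  intro c hc hc0
  obtain ⟨A, hA⟩ : ∃ A : ℤ, P.pairing k l = A :=
    ⟨P.pairingIn ℤ k l, by rw [← P.algebraMap_pairingIn ℤ k l]; simp⟩
  obtain ⟨B, hB⟩ : ∃ B : ℤ, P.pairing l k = B :=
    ⟨P.pairingIn ℤ l k, by rw [← P.algebraMap_pairingIn ℤ l k]; simp⟩
  obtain ⟨h1, h2, s1, s2, hm⟩ := ascending_and_stalls (b := b) k l hkl hA hB
    (a := -a) (c := -c) (by omega) (by omega)
  have hbr := Hecke.braid_op b k l hkl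
  have hw := X.walk_comm k l i
  generalize coxeterOrder b k l = m at *
  have hlow : ∀ (k : b.support) {n : ℤ}, P.toLinearMap i.1 (P.coroot k) = n → 0 < n →
      ∀ j : X.Shifted, j = X.reflect k i ∨ WeightLT b j.1 (X.reflect k i).1 →
        ∀ k, X.StepCompat φ j k := by
    rintro k n hn h0 j (rfl | hj)
    · exact hφ _ (X.reflect_lt k i hn h0)
    · exact hφ _ (hj.trans' (X.reflect_lt k i hn h0))
  -- At `i` itself compatibility is known only in direction `k`. Since `0 < a`, a first step along
  -- `k` leads strictly below `i`, where it is known in all directions.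
  have key : ∀ n, ascending n A B (-a) (-c) →
      braidWord (op (Hecke.gen b k)) (op (Hecke.gen b l)) n • φ (X.walk k l n i) =
        op (algebraMap LaurentZ (Hecke b) (T (-1) ^ stalls n A B (-a) (-c))) • φ i := by
    rintro (_ | n) h
    · simp [stalls, walk, braidWord]
    have e1 : -c - -a * A = -(c - a * A) := by ring
    have h' := h.2
    rw [e1] at h'
    rw [braidWord, mul_smul, walk, X.braidWord_smul_walk φ l k n _ hB hA
      (X.pairing_reflect k l i ha hc hA) (X.pairing_reflect_self k i ha) h' (hlow k ha ha0),
      smul_smul, ← op_mul, Algebra.commutes, op_mul, mul_smul, hk a ha (by omega), smul_smul,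
      ← op_mul, ← map_mul, stalls, e1, pow_add, mul_comm]
    simp only [neg_eq_zero]
  have htop := key m h1
  rw [hbr, hw, s1] at htop
  obtain ⟨m, rfl⟩ : ∃ n, m = n + 1 := ⟨m - 1, by omega⟩
  rw [braidWord, mul_smul, walk] at htop
  simp only [neg_eq_zero] at htop
  -- If `c = 0`, the walk from `l` stalls at `i` at once; its remaining `m` steps start with `k` and
  -- do not stall, so `key` sends the endpoint back to `φ i`, and the factor `q⁻¹` in `htop` is the
  -- eigenvalue of `H_l`. If `0 < c`, the remaining steps lie strictly below `i` and there are no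
  -- stalls.
  rcases hc0.eq_or_lt with rfl | hc1
  · have hr := X.reflect_eq_self l i hc
    have e1 : -a - -0 * B = -a := by ring
    have h2' := h2.2
    have s2' := s2
    rw [stalls] at s2'
    rw [e1, neg_neg] at h2' s2'
    simp only [neg_zero, if_true, Nat.add_eq_right] at s2'
    have := key m (by simpa using h2')
    rw [hr, this] at htop
    rw [hr, ← htop, neg_zero, s2']
    simp
  · have h2' := h2.2
    have s2' := s2
    have e1 : -a - -c * B = -(a - c * B) := by ring
    rw [stalls, e1] at s2'
    rw [e1] at h2'
    simp only [neg_eq_zero, hc1.ne', if_false, add_zero] at s2'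
    rw [X.braidWord_smul_walk φ k l m _ hA hB (X.pairing_reflect l k i hc ha hB)
      (X.pairing_reflect_self l i hc) h2' (hlow l hc hc1), s2'] at htop
    simpa using htop

/-- At an anti-dominant weight compatibility only concerns zero pairings, where it is the hypothesis
`hn`. At any other weight it holds by construction for the chosen descent, and `StepCompat.of_ne`
passes it to all other directions. -/
lemma WeightSet.exists_stepCompat [P.IsRootSystem] (X : WeightSet b) (n : X.Shifted → V)
    (hn : ∀ i : X.Shifted, IsAntidominant b i.1 → ∀ k, X.reflect k i = i →
      op (Hecke.gen b k) • n i = op (algebraMap LaurentZ (Hecke b) (T (-1))) • n i) :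
    ∃ φ : X.Shifted → V, (∀ i : X.Shifted, IsAntidominant b i.1 → φ i = n i) ∧
      ∀ i k, X.StepCompat φ i k := by
  classical
  choose d a ha hpos using X.exists_pos
  let F : ∀ i : X.Shifted, (∀ j : X.Shifted, WeightLT b j.1 i.1 → V) → V := fun i f =>
    if hi : IsAntidominant b i.1 then n i
    else op (Hecke.gen b (d i hi)) • f (X.reflect (d i hi) i)
      (X.reflect_lt _ i (ha i hi) (hpos i hi))
  have h1 : ∀ i : X.Shifted, IsAntidominant b i.1 → X.wf.fix F i = n i := by
    intro i hi
    rw [X.wf.fix_eq]; exact dif_pos hi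
  refine ⟨X.wf.fix F, h1, fun i => ?_⟩
  induction i using X.wf.induction with
  | _ i ih =>
    intro k
    by_cases hi : IsAntidominant b i.1
    · intro c hc hc0
      obtain rfl : c = 0 := le_antisymm (hi.nonpos k hc) hc0
      have hr := X.reflect_eq_self k i hc
      rw [hr, h1 i hi, if_pos rfl, pow_one]
      exact hn i hi k hr
    have hk : X.StepCompat (X.wf.fix F) i (d i hi) := by
      intro c hc hc0
      have hca : c = a i hi := Int.cast_injective (hc.symm.trans (ha i hi))
      rw [if_neg (by have := hpos i hi; omega), pow_zero, map_one, op_one, one_smul,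
        X.wf.fix_eq F i]
      simp only [F, dif_neg hi]
    by_cases hkd : d i hi = k
    · exact hkd ▸ hk
    · exact .of_ne hkd (ha i hi) (hpos i hi) hk ih

/-! ### The presentation of the Hecke module -/

/-- `⊕ ℤ[q, q⁻¹] v_i` is presented as a Hecke module by the generators `v_i`, `i` anti-dominant,
and the relations `v_i H_k = q⁻¹ v_i` for `i s_k = i`. -/
theorem WeightSet.exists_hom [P.IsRootSystem] (X : WeightSet b) (n : X.Shifted → V)
    (hn : ∀ i : X.Shifted, IsAntidominant b i.1 → ∀ k, X.reflect k i = i →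
      op (Hecke.gen b k) • n i = op (algebraMap LaurentZ (Hecke b) (T (-1))) • n i) :
    ∃ f : X.TMod →ₗ[(Hecke b)ᵐᵒᵖ] V, ∀ i : X.Shifted, IsAntidominant b i.1 →
      f (X.basis i) = n i := by
  obtain ⟨φ, h1, hφ⟩ := X.exists_stepCompat n hn
  let _ : Module LaurentZ V := Module.compHom V (algebraMap LaurentZ (Hecke b)ᵐᵒᵖ)
  have hs : ∀ (a : LaurentZ) (v : V), op (algebraMap LaurentZ (Hecke b) a) • v = a • v :=
    fun _ _ => rfl
  let f : X.TMod →ₗ[LaurentZ] V := X.basis.constr LaurentZ φ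
  have fb : ∀ i, f (X.basis i) = φ i := X.basis.constr_basis LaurentZ φ
  -- This is compatibility at the upper weight `i s_k`, whose pairing `-m` is positive.
  have hup : ∀ (i : X.Shifted) (k : b.support) (m : ℤ), P.toLinearMap i.1 (P.coroot k) = m → m < 0 →
      op (Hecke.gen b k) • φ i = φ (X.reflect k i) := by
    intro i k m hm h0
    have := hφ (X.reflect k i) k (-m) (X.pairing_reflect_self k i hm) (by omega)
    rwa [reflect_reflect, if_neg (by omega), pow_zero, map_one, op_one, one_smul] at this
  have hgen : ∀ k v, f (op (Hecke.gen b k) • v) = op (Hecke.gen b k) • f v := by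
    intro k v
    induction v using X.basis_induction with
    | zero => simp
    | add v w hv hw => simp only [smul_add, map_add, hv, hw]
    | smul a i =>
      have hc : ∀ v : V, op (Hecke.gen b k) • a • v = a • op (Hecke.gen b k) • v := by
        intro v
        rw [← hs, ← hs, smul_smul, smul_smul, ← op_mul, ← op_mul, Algebra.commutes]
      rw [X.op_gen_smul, map_smul, map_smul, map_smul, hc, fb]
      congr 1
      obtain ⟨m, hm⟩ := X.exists_int i k
      rcases lt_trichotomy m 0 with h | rfl | h
      · rw [X.genAct_up k i hm h, fb, hup i k m hm h]
      · have := hφ i k 0 hm le_rfl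
        rw [X.reflect_eq_self k i hm, if_pos rfl, pow_one, hs] at this
        rw [X.genAct_fix k i hm, map_smul, fb, this]
      -- Here `φ i = φ (i s_k) H_k`, so the quadratic relation computes `φ i H_k = φ (i s_k) H_k²`.
      · have h2 := hup (X.reflect k i) k (-m) (X.pairing_reflect_self k i hm) (by omega)
        rw [reflect_reflect] at h2
        rw [X.genAct_down k i hm h, map_add, map_smul, fb, fb, ← h2, smul_smul, ← op_mul,
          Hecke.gen_mul_gen, op_add, add_smul, Algebra.commutes, op_mul, mul_smul, hs, op_one,
          one_smul, add_comm]
  refine ⟨{ f with map_smul' := fun h v => ?_ }, fun i hi => (fb i).trans (h1 i hi)⟩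
  change f (h • v) = h • f v
  induction h using MulOpposite.rec' with
  | _ h =>
    induction h using Hecke.induction generalizing v with
    | scalar a => rw [X.op_algebraMap_smul, map_smul, hs]
    | gen k => exact hgen k v
    | add x y hx hy => rw [op_add, add_smul, map_add, hx, hy, add_smul]
    | mul x y hx hy => rw [op_mul, mul_smul, hy, hx, mul_smul]

end Extension

/-! ### The bar involutions on the module and on the Schur algebra -/

section Bar

variable [P.IsRootSystem] {X : WeightSet b}

lemma WeightSet.gen_smul_basis_of_fix (k : b.support) (i : X.Shifted) (h : X.reflect k i = i) :
    op (Hecke.gen b k) • X.basis i = op (algebraMap LaurentZ (Hecke b) (T (-1))) • X.basis i := by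
  rw [X.op_gen_smul, X.op_algebraMap_smul, WeightSet.genAct, Module.Basis.constr_basis, if_pos h]

lemma WeightSet.genInv_smul_of_gen_smul (k : b.support) (v : X.TMod)
    (h : op (Hecke.gen b k) • v = op (algebraMap LaurentZ (Hecke b) (T (-1))) • v) :
    op (barHecke b (Hecke.gen b k)) • v = op (algebraMap LaurentZ (Hecke b) (T 1)) • v := by
  change op (barHeckeHom b _) • v = _
  rw [barHeckeHom_gen]
  change op (Hecke.gen b k + algebraMap LaurentZ _ (T 1 - T (-1))) • v = _
  rw [op_add, add_smul, h, ← add_smul, ← op_add, ← map_add]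
  simp

/-- The Hecke module `⊕ ℤ[q, q⁻¹] v_i` with its action twisted by the bar involution. -/
def WeightSet.TwistedTMod (X : WeightSet b) : Type _ := X.TMod

instance : AddCommGroup X.TwistedTMod := inferInstanceAs (AddCommGroup X.TMod)

instance : Module (Hecke b)ᵐᵒᵖ X.TwistedTMod :=
  Module.compHom X.TMod (RingHom.op (barHecke b).toRingHom)

/-- A Hecke-linear map into the twisted module is a bar-semilinear map; semilinearity over `ℤ[q,
q⁻¹]` is the case of scalars in the Hecke algebra. -/
lemma exists_isBarT (X : WeightSet b) : ∃ β : X.TMod → X.TMod, IsBarT X β := by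
  obtain ⟨f, hf⟩ := X.exists_hom (V := X.TwistedTMod) (fun i => X.basis i)
    (by
      intro i hi k hk
      -- In the twisted module the relation to check reads `v_i H_k⁻¹ = q v_i`.
      change op (barHecke b (Hecke.gen b k)) • X.basis i =
        op (barHeckeHom b (algebraMap LaurentZ (Hecke b) (T (-1)))) • X.basis i
      rw [WeightSet.genInv_smul_of_gen_smul k _ (WeightSet.gen_smul_basis_of_fix k i hk),
        barHeckeHom_algebraMap, invert_T, neg_neg])
  let β : X.TMod → X.TMod := f
  have hs : ∀ (h : Hecke b) (v : X.TMod), β (op h • v) = op (barHecke b h) • β v :=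
    fun h v => f.map_smul (op h) v
  refine ⟨β, f.map_add, fun a v => ?_, hf, fun i h => hs h _⟩
  rw [← X.op_algebraMap_smul, hs, ← X.op_algebraMap_smul]
  congr 2
  exact barHeckeHom_algebraMap b a

variable {β : X.TMod → X.TMod}

lemma IsBarT.map_zero (hβ : IsBarT X β) : β 0 = 0 := by
  simpa using hβ.map_smul 0 0

lemma IsBarT.apply_smul_basis (hβ : IsBarT X β) {i : X.Shifted} (hi : IsAntidominant b i.1)
    (h : Hecke b) : β (op h • X.basis i) = op (barHecke b h) • X.basis i := by
  rw [hβ.act, hβ.fix i hi]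

/-- `IsBarT.act` concerns basis vectors only; on the spanning vectors `v_i g` the claim becomes
multiplicativity of the bar on the Hecke algebra. -/
lemma IsBarT.op_smul (hβ : IsBarT X β) (h : Hecke b) (v : X.TMod) :
    β (op h • v) = op (barHecke b h) • β v := by
  induction v using X.antidominant_induction with
  | add v w hv hw => rw [smul_add, hβ.map_add, hβ.map_add, hv, hw, smul_add]
  | smul i g hi =>
    rw [smul_smul, ← op_mul, hβ.apply_smul_basis hi, hβ.apply_smul_basis hi, map_mul, op_mul,
      mul_smul]
  | h0 => rw [smul_zero, hβ.map_zero, smul_zero]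

lemma IsBarT.unique {β' : X.TMod → X.TMod} (hβ : IsBarT X β) (hβ' : IsBarT X β') : β' = β := by
  funext v
  induction v using X.antidominant_induction with
  | add v w hv hw => rw [hβ.map_add, hβ'.map_add, hv, hw]
  | smul i g hi => rw [hβ.apply_smul_basis hi, hβ'.apply_smul_basis hi]
  | h0 => rw [hβ.map_zero, hβ'.map_zero]

lemma IsBarT.involutive (hβ : IsBarT X β) : Function.Involutive β := by
  intro v
  induction v using X.antidominant_induction with
  | add v w hv hw => rw [hβ.map_add, hβ.map_add, hv, hw]
  | smul i g hi =>
    rw [hβ.apply_smul_basis hi, hβ.apply_smul_basis hi]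
    exact congrArg (op · • X.basis i) (barHeckeHom_barHeckeHom b g)
  | h0 => rw [hβ.map_zero, hβ.map_zero]

lemma WeightSet.schur_ext {η θ : X.Schur}
    (h : ∀ i : X.Shifted, IsAntidominant b i.1 → η (X.basis i) = θ (X.basis i)) : η = θ := by
  refine LinearMap.ext fun v => ?_
  induction v using X.antidominant_induction with
  | add v w hv hw => rw [_root_.map_add, _root_.map_add, hv, hw]
  | smul i g hi => rw [_root_.map_smul, _root_.map_smul, h i hi]
  | h0 => rw [_root_.map_zero, _root_.map_zero]

/-- If `v_i H_k = q⁻¹ v_i`, then `η v_i` satisfies `η v_i H_k⁻¹ = q η v_i`, and applying `β` turns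
this into the relation required of the image `β (η v_i)`. -/
lemma IsBarT.exists_isBarS (hβ : IsBarT X β) : ∃ βS : X.Schur → X.Schur, IsBarS X β βS := by
  have : ∀ η : X.Schur, ∃ θ : X.Schur, ∀ i : X.Shifted, IsAntidominant b i.1 →
      θ (X.basis i) = β (η (X.basis i)) := by
    intro η
    refine X.exists_hom (fun i => β (η (X.basis i))) fun i hi k hk => ?_
    have h1 : op (barHecke b (Hecke.gen b k)) • η (X.basis i) =
        op (algebraMap LaurentZ (Hecke b) (T 1)) • η (X.basis i) := by
      rw [← _root_.map_smul η, ← _root_.map_smul η, WeightSet.genInv_smul_of_gen_smul k _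
        (WeightSet.gen_smul_basis_of_fix k i hk)]
    have h2 := congrArg β h1
    rw [hβ.op_smul, hβ.op_smul] at h2
    change op (barHeckeHom b (barHeckeHom b _)) • _ = op (barHeckeHom b _) • _ at h2
    rwa [barHeckeHom_barHeckeHom, barHeckeHom_algebraMap, invert_T] at h2
  choose βS h using this
  exact ⟨βS, fun η i hi g => by rw [_root_.map_smul, h η i hi]⟩

variable {βS : X.Schur → X.Schur}

lemma IsBarS.apply_basis (hS : IsBarS X β βS) (η : X.Schur) {i : X.Shifted}
    (hi : IsAntidominant b i.1) : βS η (X.basis i) = β (η (X.basis i)) := by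
  simpa using hS η i hi 1

lemma IsBarS.unique {βS' : X.Schur → X.Schur} (hS : IsBarS X β βS) (hS' : IsBarS X β βS') :
    βS' = βS :=
  funext fun η => WeightSet.schur_ext fun _ hi => by
    rw [hS.apply_basis η hi, hS'.apply_basis η hi]

lemma IsBarS.involutive (hβ : IsBarT X β) (hS : IsBarS X β βS) : Function.Involutive βS :=
  fun η => WeightSet.schur_ext fun _ hi => by
    rw [hS.apply_basis _ hi, hS.apply_basis η hi, hβ.involutive]

/-- For `v = v_i g` with `i` anti-dominant, both sides equal `β (η v_i)` times the bar of `g`,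
because `β` fixes `v_i`. -/
lemma IsBarS.bar_apply (hβ : IsBarT X β) (hS : IsBarS X β βS) (η : X.Schur) (v : X.TMod) :
    β (η v) = βS η (β v) := by
  induction v using X.antidominant_induction with
  | add v w hv hw => rw [_root_.map_add, hβ.map_add, hβ.map_add, _root_.map_add, hv, hw]
  | smul i g hi =>
    rw [_root_.map_smul, hβ.op_smul, hβ.apply_smul_basis hi, _root_.map_smul, hS.apply_basis η hi]
  | h0 => rw [_root_.map_zero, hβ.map_zero, _root_.map_zero]

end Bar

end Presentation

end QSchur

end

theorem mainTheorem10 {𝔤 : Type*} [LieRing 𝔤] [LieAlgebra ℂ 𝔤] [FiniteDimensional ℂ 𝔤]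
    [LieAlgebra.IsSimple ℂ 𝔤] (𝔥 : LieSubalgebra ℂ 𝔤) [𝔥.IsCartanSubalgebra]
    (b : (LieAlgebra.IsKilling.rootSystem 𝔥).Base) (X : QSchur.WeightSet b) :
    (∃! βT : X.TMod → X.TMod, QSchur.IsBarT X βT) ∧
    ∀ βT : X.TMod → X.TMod, QSchur.IsBarT X βT →
      Function.Involutive βT ∧
      (∃! βS : X.Schur → X.Schur, QSchur.IsBarS X βT βS) ∧
      ∀ βS : X.Schur → X.Schur, QSchur.IsBarS X βT βS →
        Function.Involutive βS ∧
        ∀ (η : X.Schur) (v : X.TMod) (h : QSchur.Hecke b),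
          βT (MulOpposite.op h • η v) =
            MulOpposite.op (QSchur.barHecke b h) • (βS η) (βT v) := by
  obtain ⟨β, hβ⟩ := QSchur.exists_isBarT X
  refine ⟨⟨β, hβ, fun β' hβ' => hβ.unique hβ'⟩, fun βT hT => ⟨hT.involutive, ?_, ?_⟩⟩
  · obtain ⟨βS, hS⟩ := hT.exists_isBarS
    exact ⟨βS, hS, fun βS' hS' => hS.unique hS'⟩
  · intro βS hS
    refine ⟨hS.involutive hT, fun η v h => ?_⟩
    rw [hT.op_smul, hS.bar_apply hT]
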